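/- Let $M$ be a smooth (Hausdorff, finite-dimensional) manifold with a smooth Riemannian metric $g$ and Levi-Civita connection $\nabla$, and let $P$ be a smooth tensor field of type $(1,1)$ on $M$ with $P^2=\mathrm{id}$, $g(Px,Py)=g(x,y)$ and $\operatorname{tr}P=0$. Put $(\nabla_xP)y=\nabla_x(Py)-P\nabla_xy$ and $F(x,y,z)=g((\nabla_xP)y,z)$. Suppose that $(M,P,g)$ is a Riemannian $\mathcal W_3$-manifold, that is, $$F(x,y,z)+F(y,z,x)+F(z,x,y)=0$$ for all smooth vector fields $x,y,z$. Let $\nabla'$ be the canonical connection of $(M,P,g)$, that is, the linear connection with $\nabla'P=0$ and $\nabla'g=0$ whose torsion $T(x,y)=\nabla'_xy-\nabla'_yx-[x,y]$, with $T(x,y,z)=g(T(x,y),z)$, satisfies $$T(x,y,z)+T(y,z,x)+T(Px,y,Pz)+T(y,Pz,Px)=0 .$$ Suppose that its curvature tensor $R'(x,y,z,w)=g(\nabla'_x\nabla'_yz-\nabla'_y\nabla'_xz-\nabla'_{[x,y]}z,\,w)$ is a Riemannian $P$-tensor, that is, for all smooth vector fields $x,y,z,w$, $$R'(x,y,z,w)=-R'(y,x,z,w)=-R'(x,y,w,z),$$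 $$R'(x,y,z,w)+R'(y,z,x,w)+R'(z,x,y,w)=0,$$ $$R'(x,y,Pz,Pw)=R'(x,y,z,w).$$ Then $$g\bigl((\nabla_xP)Pz+(\nabla_{Px}P)z,\ (\nabla_{Py}P)w-(\nabla_yP)Pw\bigr)=0$$ for all smooth vector fields $x,y,z,w$ on $M$. -/

import Mathlib

open Bundle
open scoped Manifold ContDiff

noncomputable section

namespace AlmostProduct

variable {m : ℕ} {M : Type*} [TopologicalSpace M] [ChartedSpace (EuclideanSpace ℝ (Fin m)) M]

/-- Vector fields on `M` (without any regularity). -/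
abbrev VF (m : ℕ) (M : Type*) [TopologicalSpace M] [ChartedSpace (EuclideanSpace ℝ (Fin m)) M] :
    Type _ :=
  ∀ p : M, TangentSpace (𝓡 m) p

/-- Fields of endomorphisms of the tangent spaces (without any regularity). -/
abbrev EndField (m : ℕ) (M : Type*) [TopologicalSpace M]
    [ChartedSpace (EuclideanSpace ℝ (Fin m)) M] : Type _ :=
  ∀ p : M, TangentSpace (𝓡 m) p →L[ℝ] TangentSpace (𝓡 m) p

/-- The vector field `P X`. -/
def EndField.app (P : EndField m M) (X : VF m M) : VF m M := fun p ↦ P p (X p)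

variable [IsManifold (𝓡 m) ∞ M]

/-- `X` is a smooth vector field. -/
def IsSmoothVF (X : VF m M) : Prop :=
  ContMDiff (𝓡 m) (𝓡 m).tangent ∞ (fun p ↦ (⟨p, X p⟩ : TangentBundle (𝓡 m) M))

/-- `P` is a smooth tensor field of type `(1,1)`, that is, a smooth section of the bundle
`Hom(TM, TM)`. -/
def IsSmoothEnd (P : EndField m M) : Prop :=
  ContMDiff (𝓡 m)
    ((𝓡 m).prod 𝓘(ℝ, EuclideanSpace ℝ (Fin m) →L[ℝ] EuclideanSpace ℝ (Fin m))) ∞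
    (fun p ↦ TotalSpace.mk' (EuclideanSpace ℝ (Fin m) →L[ℝ] EuclideanSpace ℝ (Fin m))
      (E := fun q : M ↦ TangentSpace (𝓡 m) q →L[ℝ] TangentSpace (𝓡 m) q) p (P p))

/-- Linear connections on `M`: covariant derivatives on the tangent bundle. Smoothness is a
separate condition, imposed in `IsLeviCivita` and `IsNatural` below. -/
abbrev Conn (m : ℕ) (M : Type*) [TopologicalSpace M] [ChartedSpace (EuclideanSpace ℝ (Fin m)) M]
    [IsManifold (𝓡 m) ∞ M] : Type _ :=
  CovariantDerivative (𝓡 m) (EuclideanSpace ℝ (Fin m)) (fun p : M ↦ TangentSpace (𝓡 m) p)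

/-- The vector field `∇_X Y`. -/
def nabla (D : Conn m M) (X Y : VF m M) : VF m M := fun p ↦ D Y p (X p)

/-- The vector field `(∇_X P) Y = ∇_X (P Y) - P (∇_X Y)`. -/
def nablaEnd (D : Conn m M) (P : EndField m M) (X Y : VF m M) : VF m M :=
  nabla D X (P.app Y) - P.app (nabla D X Y)

/-- The curvature `R(X, Y) Z = ∇_X ∇_Y Z - ∇_Y ∇_X Z - ∇_[X, Y] Z`. -/
def curvature (D : Conn m M) (X Y Z : VF m M) : VF m M :=
  nabla D X (nabla D Y Z) - nabla D Y (nabla D X Z)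
    - nabla D (VectorField.mlieBracket (𝓡 m) X Y) Z

variable [RiemannianBundle (fun p : M ↦ TangentSpace (𝓡 m) p)]

/-- The function `g(X, Y)`. -/
def gmet (X Y : VF m M) : M → ℝ := fun p ↦ inner ℝ (X p) (Y p)

/-- The curvature tensor of type `(0,4)`, `R(X, Y, Z, W) = g(R(X, Y) Z, W)`. -/
def curvature₄ (D : Conn m M) (X Y Z W : VF m M) : M → ℝ := gmet (curvature D X Y Z) W

/-- `L` (a tensor field of type `(0,4)`, given by its values on vector fields) is
curvature-like. -/
structure IsCurvatureLike (L : VF m M → VF m M → VF m M → VF m M → M → ℝ) : Prop where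
  skew_left : ∀ X Y Z W, IsSmoothVF X → IsSmoothVF Y → IsSmoothVF Z → IsSmoothVF W →
    L X Y Z W = -L Y X Z W
  skew_right : ∀ X Y Z W, IsSmoothVF X → IsSmoothVF Y → IsSmoothVF Z → IsSmoothVF W →
    L X Y Z W = -L X Y W Z
  bianchi : ∀ X Y Z W, IsSmoothVF X → IsSmoothVF Y → IsSmoothVF Z → IsSmoothVF W →
    L X Y Z W + L Y Z X W + L Z X Y W = 0

/-- `L` is a Riemannian `P`-tensor: a curvature-like tensor with
`L(X, Y, PZ, PW) = L(X, Y, Z, W)`. -/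
structure IsRiemannianPTensor (P : EndField m M)
    (L : VF m M → VF m M → VF m M → VF m M → M → ℝ) : Prop extends IsCurvatureLike L where
  invariant : ∀ X Y Z W, IsSmoothVF X → IsSmoothVF Y → IsSmoothVF Z → IsSmoothVF W →
    L X Y (P.app Z) (P.app W) = L X Y Z W

/-- `P` makes the Riemannian manifold `M` a Riemannian almost product manifold with
`tr P = 0`. -/
structure IsAlmostProduct (P : EndField m M) : Prop where
  smooth : IsSmoothEnd P
  sq : ∀ (p : M) (v : TangentSpace (𝓡 m) p), P p (P p v) = v
  isometry : ∀ (p : M) (v w : TangentSpace (𝓡 m) p), inner ℝ (P p v) (P p w) = inner ℝ v w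
  trace_eq_zero : ∀ p : M,
    LinearMap.trace ℝ (TangentSpace (𝓡 m) p) (P p : TangentSpace (𝓡 m) p →ₗ[ℝ] _) = 0

/-- The tensor `F(X, Y, Z) = g((∇_X P) Y, Z)`. -/
def tensorF (D : Conn m M) (P : EndField m M) (X Y Z : VF m M) : M → ℝ :=
  gmet (nablaEnd D P X Y) Z

/-- The condition defining the class `W₃`: the cyclic sum of `F` vanishes, where `D` is the
Levi-Civita connection. -/
def IsW3 (D : Conn m M) (P : EndField m M) : Prop :=
  ∀ X Y Z : VF m M, IsSmoothVF X → IsSmoothVF Y → IsSmoothVF Z →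
    tensorF D P X Y Z + tensorF D P Y Z X + tensorF D P Z X Y = 0

variable [IsContMDiffRiemannianBundle (𝓡 m) ∞ (EuclideanSpace ℝ (Fin m))
  (fun p : M ↦ TangentSpace (𝓡 m) p)]

/-- A smooth metric is `C¹` (an instance that is needed to speak of metric connections). -/
instance isContMDiffRiemannianBundle_one :
    IsContMDiffRiemannianBundle (𝓡 m) 1 (EuclideanSpace ℝ (Fin m))
      (fun p : M ↦ TangentSpace (𝓡 m) p) :=
  IsContMDiffRiemannianBundle.of_le (n := ∞) (by norm_cast)

/-- `D` is the Levi-Civita connection of the metric: the smooth, torsion-free, metric linear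
connection. -/
structure IsLeviCivita (D : Conn m M) : Prop where
  smooth : CovariantDerivative.ContMDiffCovariantDerivative D ∞
  torsion_eq_zero : D.torsion = 0
  metric : D.IsMetricCompatible

/-- `D'` is a natural connection: a smooth linear connection with `∇' P = 0` and `∇' g = 0`. -/
structure IsNatural (P : EndField m M) (D' : Conn m M) : Prop where
  smooth : CovariantDerivative.ContMDiffCovariantDerivative D' ∞
  parallel : ∀ X Y : VF m M, IsSmoothVF X → IsSmoothVF Y → nablaEnd D' P X Y = 0
  metric : D'.IsMetricCompatible

/-- The torsion tensor of type `(0,3)`, `T(x, y, z) = g(T(x, y), z)`. -/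
def torsion₃ (D' : Conn m M) (p : M) (x y z : TangentSpace (𝓡 m) p) : ℝ :=
  inner ℝ (D'.torsion p x y) z

/-- `D'` is the canonical connection: the natural connection whose torsion satisfies
`T(x, y, z) + T(y, z, x) + T(Px, y, Pz) + T(y, Pz, Px) = 0`. -/
structure IsCanonical (P : EndField m M) (D' : Conn m M) : Prop extends IsNatural P D' where
  torsion_eq : ∀ (p : M) (x y z : TangentSpace (𝓡 m) p),
    torsion₃ D' p x y z + torsion₃ D' p y z x
      + torsion₃ D' p (P p x) y (P p z) + torsion₃ D' p y (P p z) (P p x) = 0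

end AlmostProduct

end

/-! Split the tangent bundle into the eigenbundles of `P` for the eigenvalues `ε = ±1` (the two
types) and let `S(X, Y) = ∇'_X Y - ∇_X Y`. Since `∇'P = 0`, `∇'` preserves types, and `∇P` is the
commutator of `P` with `S`; so it swaps types. The `W₃` condition makes `g(S(X, Y), C)` skew in `X,
Y` of one type when `C` is of the other. With the torsion identity this shows that the torsion `T`
of `∇'` vanishes on arguments of different types (`IsCanonical.torsionField_eq_zero`), and takes two
arguments of one type to the other (`IsCanonical.app_torsionField`).

For `X, Y, Z` of type `ε` and `A` of type `-ε`, pair the first Bianchi identity of `R'` for `X, Y,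
A` with `Z`. Every torsion term is orthogonal to `Z` except `g(T(A, T(X, Y)), Z)`, which therefore
vanishes (`IsCanonical.gmet_torsionField_torsionField`). Up to a constant it equals `g((∇_X P)Y,
(∇_A P)Z)`.

The expression of the theorem is a combination of four such products of eigencomponents: two vanish
in this way, and two because their factors are of different types. -/

noncomputable section

namespace AlmostProduct

/-! ### Algebra of endomorphism fields. -/

section EndField

variable {m : ℕ} {M : Type*} [TopologicalSpace M] [ChartedSpace (EuclideanSpace ℝ (Fin m)) M]

lemma app_add (P : EndField m M) (X Y : VF m M) : P.app (X + Y) = P.app X + P.app Y :=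
  funext fun p ↦ map_add (P p) (X p) (Y p)

lemma app_sub (P : EndField m M) (X Y : VF m M) : P.app (X - Y) = P.app X - P.app Y :=
  funext fun p ↦ map_sub (P p) (X p) (Y p)

lemma app_smul (P : EndField m M) (c : ℝ) (X : VF m M) : P.app (c • X) = c • P.app X :=
  funext fun p ↦ map_smul (P p) c (X p)

lemma eq_zero_of_app_eq {P : EndField m M} {U : VF m M} {ε : ℝ} (hε : ε * ε = 1)
    (h1 : P.app U = ε • U) (h2 : P.app U = (-ε) • U) : U = 0 := by
  linear_combination (norm := module) (ε / 2) • (h2 - h1) - hε • U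

end EndField

/-! ### Calculus of connections and torsion on smooth vector fields. -/

section Smooth

variable {m : ℕ} {M : Type*} [TopologicalSpace M] [ChartedSpace (EuclideanSpace ℝ (Fin m)) M]
  [IsManifold (𝓡 m) ∞ M] {X Y Z : VF m M} {P : EndField m M} {D D' : Conn m M}

lemma IsSmoothVF.mdifferentiableAt (hX : IsSmoothVF X) (p : M) :
    MDifferentiableAt (𝓡 m) (𝓡 m).tangent (fun p ↦ (⟨p, X p⟩ : TangentBundle (𝓡 m) M)) p :=
  (ContMDiff.mdifferentiable hX (by simp)) p

lemma IsSmoothVF.add (hX : IsSmoothVF X) (hY : IsSmoothVF Y) : IsSmoothVF (X + Y) :=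
  ContMDiff.add_section hX hY

lemma IsSmoothVF.sub (hX : IsSmoothVF X) (hY : IsSmoothVF Y) : IsSmoothVF (X - Y) :=
  ContMDiff.sub_section hX hY

lemma IsSmoothVF.smul (hX : IsSmoothVF X) (c : ℝ) : IsSmoothVF (c • X) :=
  ContMDiff.const_smul_section (a := c) hX

lemma IsSmoothVF.app (hP : IsSmoothEnd P) (hX : IsSmoothVF X) : IsSmoothVF (P.app X) :=
  ContMDiff.clm_bundle_apply (b := fun p ↦ p) hP hX

lemma IsSmoothVF.nabla (hD : CovariantDerivative.ContMDiffCovariantDerivative D ∞)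
    (hX : IsSmoothVF X) (hY : IsSmoothVF Y) : IsSmoothVF (nabla D X Y) :=
  ContMDiff.clm_bundle_apply (b := fun p ↦ p)
    (contMDiffOn_univ.1 (hD.contMDiff.contMDiff (contMDiffOn_univ.2 hY))) hX

lemma nabla_add_left (D : Conn m M) (X Y Z : VF m M) :
    nabla D (X + Y) Z = nabla D X Z + nabla D Y Z :=
  funext fun p ↦ map_add (D Z p) (X p) (Y p)

lemma nabla_sub_left (D : Conn m M) (X Y Z : VF m M) :
    nabla D (X - Y) Z = nabla D X Z - nabla D Y Z :=
  funext fun p ↦ map_sub (D Z p) (X p) (Y p)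

lemma nabla_add_right (D : Conn m M) (X : VF m M) (hY : IsSmoothVF Y) (hZ : IsSmoothVF Z) :
    nabla D X (Y + Z) = nabla D X Y + nabla D X Z :=
  funext fun p ↦ congr($(D.isCovariantDerivativeOnUniv.add (hY.mdifferentiableAt p)
    (hZ.mdifferentiableAt p)) (X p))

lemma nabla_smul_right (D : Conn m M) (X : VF m M) (c : ℝ) (hY : IsSmoothVF Y) :
    nabla D X (c • Y) = c • nabla D X Y :=
  funext fun p ↦ congr($(D.isCovariantDerivativeOnUniv.smul_const c
    (hY.mdifferentiableAt p)) (X p))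

lemma nabla_sub_right (D : Conn m M) (X : VF m M) (hY : IsSmoothVF Y) (hZ : IsSmoothVF Z) :
    nabla D X (Y - Z) = nabla D X Y - nabla D X Z := by
  have h : Y - Z = Y + (-1 : ℝ) • Z := by module
  rw [h, nabla_add_right D X hY (hZ.smul _), nabla_smul_right D X _ hZ]
  module

lemma nablaEnd_add_left (D : Conn m M) (P : EndField m M) (X Y Z : VF m M) :
    nablaEnd D P (X + Y) Z = nablaEnd D P X Z + nablaEnd D P Y Z := by
  simp only [nablaEnd, nabla_add_left, app_add]
  module

lemma nablaEnd_sub_left (D : Conn m M) (P : EndField m M) (X Y Z : VF m M) :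
    nablaEnd D P (X - Y) Z = nablaEnd D P X Z - nablaEnd D P Y Z := by
  simp only [nablaEnd, nabla_sub_left, app_sub]
  module

lemma nablaEnd_add_right (D : Conn m M) (hP : IsSmoothEnd P) (X : VF m M) (hY : IsSmoothVF Y)
    (hZ : IsSmoothVF Z) : nablaEnd D P X (Y + Z) = nablaEnd D P X Y + nablaEnd D P X Z := by
  simp only [nablaEnd, app_add, nabla_add_right D X hY hZ,
    nabla_add_right D X (hY.app hP) (hZ.app hP)]
  module

lemma nablaEnd_sub_right (D : Conn m M) (hP : IsSmoothEnd P) (X : VF m M) (hY : IsSmoothVF Y)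
    (hZ : IsSmoothVF Z) : nablaEnd D P X (Y - Z) = nablaEnd D P X Y - nablaEnd D P X Z := by
  simp only [nablaEnd, app_sub, nabla_sub_right D X hY hZ,
    nabla_sub_right D X (hY.app hP) (hZ.app hP)]
  module

/-- The torsion of `D` evaluated on vector fields. -/
def torsionField (D : Conn m M) (X Y : VF m M) : VF m M :=
  nabla D X Y - nabla D Y X - VectorField.mlieBracket (𝓡 m) X Y

lemma torsion_eq_torsionField (D : Conn m M) (hX : IsSmoothVF X) (hY : IsSmoothVF Y) (p : M) :
    D.torsion p (X p) (Y p) = torsionField D X Y p :=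
  D.torsion_apply (hX.mdifferentiableAt p) (hY.mdifferentiableAt p)

lemma torsionField_swap (D : Conn m M) (X Y : VF m M) :
    torsionField D X Y = - torsionField D Y X := by
  rw [torsionField, torsionField, VectorField.mlieBracket_swap]
  module

lemma torsionField_sub_right (D : Conn m M) (hX : IsSmoothVF X) (hY : IsSmoothVF Y)
    (hZ : IsSmoothVF Z) :
    torsionField D X (Y - Z) = torsionField D X Y - torsionField D X Z := by
  funext p
  simp only [Pi.sub_apply, ← torsion_eq_torsionField D hX hY, ← torsion_eq_torsionField D hX hZ,
    ← torsion_eq_torsionField D hX (hY.sub hZ), map_sub]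

lemma torsionField_add_right (D : Conn m M) (hX : IsSmoothVF X) (hY : IsSmoothVF Y)
    (hZ : IsSmoothVF Z) :
    torsionField D X (Y + Z) = torsionField D X Y + torsionField D X Z := by
  funext p
  simp only [Pi.add_apply, ← torsion_eq_torsionField D hX hY, ← torsion_eq_torsionField D hX hZ,
    ← torsion_eq_torsionField D hX (hY.add hZ), map_add]

lemma torsionField_smul_right (D : Conn m M) (c : ℝ) (hX : IsSmoothVF X) (hY : IsSmoothVF Y) :
    torsionField D X (c • Y) = c • torsionField D X Y := by
  funext p
  simp only [Pi.smul_apply, ← torsion_eq_torsionField D hX hY,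
    ← torsion_eq_torsionField D hX (hY.smul c), map_smul]

lemma IsSmoothVF.mlieBracket (hX : IsSmoothVF X) (hY : IsSmoothVF Y) :
    IsSmoothVF (VectorField.mlieBracket (𝓡 m) X Y) := by
  have : IsManifold (𝓡 m) ((⊤ : ℕ∞) + 1) M := .of_le (n := ∞) (by norm_cast)
  have : IsManifold (𝓡 m) (minSmoothness ℝ 2) M :=
    .of_le (n := ∞) (by simpa using (mod_cast le_top : ((2 : ℕ∞) : WithTop ℕ∞) ≤ ∞))
  exact ContDiff.mlieBracket_vectorField (n := ⊤) (m := ⊤) hX hY (by simp)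

lemma IsSmoothVF.torsionField (hD : CovariantDerivative.ContMDiffCovariantDerivative D ∞)
    (hX : IsSmoothVF X) (hY : IsSmoothVF Y) : IsSmoothVF (torsionField D X Y) :=
  ((hX.nabla hD hY).sub (hY.nabla hD hX)).sub (hX.mlieBracket hY)

lemma mlieBracket_jacobi (hX : IsSmoothVF X) (hY : IsSmoothVF Y) (hZ : IsSmoothVF Z) :
    VectorField.mlieBracket (𝓡 m) X (VectorField.mlieBracket (𝓡 m) Y Z)
      + VectorField.mlieBracket (𝓡 m) Y (VectorField.mlieBracket (𝓡 m) Z X)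
      + VectorField.mlieBracket (𝓡 m) Z (VectorField.mlieBracket (𝓡 m) X Y) = 0 := by
  have hle : minSmoothness ℝ 2 ≤ (∞ : WithTop ℕ∞) := by
    simpa using (mod_cast le_top : ((2 : ℕ∞) : WithTop ℕ∞) ≤ ∞)
  have : IsManifold (𝓡 m) (minSmoothness ℝ 3) M :=
    .of_le (n := ∞) (by simpa using (mod_cast le_top : ((3 : ℕ∞) : WithTop ℕ∞) ≤ ∞))
  have h := VectorField.leibniz_identity_mlieBracket (I := 𝓡 m) (ContMDiff.of_le hX hle)
    (ContMDiff.of_le hY hle) (ContMDiff.of_le hZ hle)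
  have e : VectorField.mlieBracket (𝓡 m) Y (VectorField.mlieBracket (𝓡 m) Z X)
      = - VectorField.mlieBracket (𝓡 m) Y (VectorField.mlieBracket (𝓡 m) X Z) := by
    funext p
    rw [VectorField.mlieBracket_swap (V := Z), ← neg_one_smul ℝ,
      VectorField.mlieBracket_const_smul_right ((hX.mlieBracket hZ).mdifferentiableAt p),
      Pi.neg_apply, neg_one_smul]
  rw [h, e, VectorField.mlieBracket_swap (V := Z)]
  module

/-- The first Bianchi identity of a linear connection with torsion. -/
lemma curvature_cyclic_sum (hD : CovariantDerivative.ContMDiffCovariantDerivative D ∞)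
    (hX : IsSmoothVF X) (hY : IsSmoothVF Y) (hZ : IsSmoothVF Z) :
    curvature D X Y Z + curvature D Y Z X + curvature D Z X Y =
      torsionField D X (VectorField.mlieBracket (𝓡 m) Y Z)
        + torsionField D Y (VectorField.mlieBracket (𝓡 m) Z X)
        + torsionField D Z (VectorField.mlieBracket (𝓡 m) X Y)
        + nabla D X (torsionField D Y Z) + nabla D Y (torsionField D Z X)
        + nabla D Z (torsionField D X Y) := by
  have key {U V W : VF m M} (hV : IsSmoothVF V) (hW : IsSmoothVF W) :
      nabla D U (torsionField D V W) = nabla D U (nabla D V W) - nabla D U (nabla D W V)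
        - nabla D U (VectorField.mlieBracket (𝓡 m) V W) := by
    rw [torsionField, nabla_sub_right D U ((hV.nabla hD hW).sub (hW.nabla hD hV))
      (hV.mlieBracket hW), nabla_sub_right D U (hV.nabla hD hW) (hW.nabla hD hV)]
  rw [key hX hY, key hY hZ, key hZ hX]
  simp only [curvature, torsionField]
  -- All terms containing the connection cancel; the double brackets left over are those of the
  -- Jacobi identity.
  linear_combination (norm := module) mlieBracket_jacobi hX hY hZ

end Smooth

/-! ### The metric and the eigenfields of `P`. -/

section Metric

variable {m : ℕ} {M : Type*} [TopologicalSpace M] [ChartedSpace (EuclideanSpace ℝ (Fin m)) M]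
  [RiemannianBundle (fun p : M ↦ TangentSpace (𝓡 m) p)]

lemma gmet_comm (X Y : VF m M) (p : M) : gmet X Y p = gmet Y X p :=
  real_inner_comm _ _

lemma gmet_add_left (X Y Z : VF m M) (p : M) : gmet (X + Y) Z p = gmet X Z p + gmet Y Z p :=
  inner_add_left _ _ _

lemma gmet_sub_left (X Y Z : VF m M) (p : M) : gmet (X - Y) Z p = gmet X Z p - gmet Y Z p :=
  inner_sub_left _ _ _

lemma gmet_neg_left (X Y : VF m M) (p : M) : gmet (-X) Y p = -gmet X Y p :=
  inner_neg_left _ _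

lemma gmet_smul_left (c : ℝ) (X Y : VF m M) (p : M) : gmet (c • X) Y p = c * gmet X Y p :=
  real_inner_smul_left _ _ _

lemma gmet_sub_right (X Y Z : VF m M) (p : M) : gmet X (Y - Z) p = gmet X Y p - gmet X Z p :=
  inner_sub_right _ _ _

lemma gmet_smul_right (c : ℝ) (X Y : VF m M) (p : M) : gmet X (c • Y) p = c * gmet X Y p :=
  real_inner_smul_right _ _ _

lemma eq_zero_of_gmet_self {X : VF m M} (h : ∀ p, gmet X X p = 0) : X = 0 :=
  funext fun p ↦ inner_self_eq_zero.1 (h p)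

variable [IsManifold (𝓡 m) ∞ M] {P : EndField m M} {X Y Z U : VF m M} {ε : ℝ}

lemma IsAlmostProduct.app_app (hP : IsAlmostProduct P) (X : VF m M) : P.app (P.app X) = X :=
  funext fun p ↦ hP.sq p (X p)

lemma IsAlmostProduct.gmet_app_left (hP : IsAlmostProduct P) (X Y : VF m M) (p : M) :
    gmet (P.app X) Y p = gmet X (P.app Y) p := by
  have h : gmet (P.app X) (P.app (P.app Y)) p = gmet X (P.app Y) p := hP.isometry p _ _
  rwa [hP.app_app] at h

/-- Eigenfields of `P` for different eigenvalues are orthogonal. -/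
lemma IsAlmostProduct.gmet_eq_zero (hP : IsAlmostProduct P) (hε : ε * ε = 1)
    (hX : P.app X = ε • X) (hY : P.app Y = (-ε) • Y) (p : M) : gmet X Y p = 0 := by
  have h := hP.gmet_app_left X Y p
  rw [hX, hY, gmet_smul_left, gmet_smul_right] at h
  linear_combination ε / 2 * h - gmet X Y p * hε

lemma IsAlmostProduct.app_add_smul (hP : IsAlmostProduct P) (hε : ε * ε = 1) (U : VF m M) :
    P.app (U + ε • P.app U) = ε • (U + ε • P.app U) := by
  rw [app_add, app_smul, hP.app_app]
  linear_combination (norm := module) (-hε) • P.app U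

/-- A smooth vector field that is orthogonal to all eigenfields for the eigenvalue `ε` is an
eigenfield for the eigenvalue `-ε`. -/
lemma IsAlmostProduct.app_eq_neg_smul (hP : IsAlmostProduct P) (hε : ε * ε = 1)
    (hU : IsSmoothVF U)
    (h : ∀ Z : VF m M, IsSmoothVF Z → P.app Z = ε • Z → ∀ p, gmet U Z p = 0) :
    P.app U = (-ε) • U := by
  -- `U + ε P U` is twice the `ε`-component of `U` and itself a smooth eigenfield, so it may serve
  -- as the test field.
  have h0 : U + ε • P.app U = 0 := eq_zero_of_gmet_self fun p ↦ by
    have e := hP.app_add_smul hε U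
    have h1 := h _ (hU.add ((hU.app hP.smooth).smul ε)) e p
    have h2 := hP.gmet_app_left U (U + ε • P.app U) p
    rw [e, gmet_smul_right, h1] at h2
    rw [gmet_add_left, gmet_smul_left, h1, h2]
    ring
  linear_combination (norm := module) ε • h0 - hε • P.app U

/-- Differentiating `P² = id` shows that `∇_X P` anticommutes with `P`, hence exchanges the two
types. -/
lemma app_nablaEnd (hP : IsAlmostProduct P) (D : Conn m M) (hε : ε * ε = 1) (X : VF m M)
    (hY : IsSmoothVF Y) (hPY : P.app Y = ε • Y) :
    P.app (nablaEnd D P X Y) = (-ε) • nablaEnd D P X Y := by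
  rw [nablaEnd, hPY, nabla_smul_right D X ε hY, app_sub, app_smul, hP.app_app]
  linear_combination (norm := module) hε • nabla D X Y

end Metric

/-! ### The torsion of the canonical connection on a `W₃`-manifold. -/

section Canonical

variable {m : ℕ} {M : Type*} [TopologicalSpace M] [ChartedSpace (EuclideanSpace ℝ (Fin m)) M]
  [IsManifold (𝓡 m) ∞ M] [RiemannianBundle (fun p : M ↦ TangentSpace (𝓡 m) p)]
  [IsContMDiffRiemannianBundle (𝓡 m) ∞ (EuclideanSpace ℝ (Fin m))
    (fun p : M ↦ TangentSpace (𝓡 m) p)]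
  {P : EndField m M} {D D' : Conn m M} {X Y Z W A C : VF m M} {ε : ℝ}

/-- The difference of two metric connections is skew-symmetric. -/
lemma gmet_nabla_sub_nabla_skew (hD : D.IsMetricCompatible) (hD' : D'.IsMetricCompatible)
    (X : VF m M) (hY : IsSmoothVF Y) (hZ : IsSmoothVF Z) (p : M) :
    gmet (nabla D' X Y - nabla D X Y) Z p = -gmet (nabla D' X Z - nabla D X Z) Y p := by
  have h := (hD.mvfderiv_inner_eq X (hY.mdifferentiableAt p) (hZ.mdifferentiableAt p)).symm.trans
    (hD'.mvfderiv_inner_eq X (hY.mdifferentiableAt p) (hZ.mdifferentiableAt p))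
  change gmet (nabla D X Y) Z p + gmet Y (nabla D X Z) p
    = gmet (nabla D' X Y) Z p + gmet Y (nabla D' X Z) p at h
  rw [gmet_comm Y, gmet_comm Y] at h
  rw [gmet_sub_left, gmet_sub_left]
  linear_combination -h

lemma IsLeviCivita.mlieBracket_eq (hD : IsLeviCivita D) (hX : IsSmoothVF X) (hY : IsSmoothVF Y) :
    VectorField.mlieBracket (𝓡 m) X Y = nabla D X Y - nabla D Y X :=
  funext fun p ↦ (D.torsion_eq_zero_iff.1 hD.torsion_eq_zero (hX.mdifferentiableAt p)
    (hY.mdifferentiableAt p)).symm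

lemma IsLeviCivita.torsionField_eq (hD : IsLeviCivita D) (D' : Conn m M) (hX : IsSmoothVF X)
    (hY : IsSmoothVF Y) :
    torsionField D' X Y = (nabla D' X Y - nabla D X Y) - (nabla D' Y X - nabla D Y X) := by
  rw [torsionField, hD.mlieBracket_eq hX hY]
  module

lemma IsLeviCivita.gmet_torsionField (hD : IsLeviCivita D) (D' : Conn m M) (hX : IsSmoothVF X)
    (hY : IsSmoothVF Y) (Z : VF m M) (p : M) :
    gmet (torsionField D' X Y) Z p
      = gmet (nabla D' X Y - nabla D X Y) Z p - gmet (nabla D' Y X - nabla D Y X) Z p := by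
  rw [hD.torsionField_eq D' hX hY, gmet_sub_left]

lemma IsNatural.nabla_app (hD' : IsNatural P D') (hX : IsSmoothVF X) (hY : IsSmoothVF Y) :
    nabla D' X (P.app Y) = P.app (nabla D' X Y) :=
  sub_eq_zero.1 (hD'.parallel X Y hX hY)

lemma IsNatural.nablaEnd_eq (hD' : IsNatural P D') (D : Conn m M) (hX : IsSmoothVF X)
    (hY : IsSmoothVF Y) :
    nablaEnd D P X Y = P.app (nabla D' X Y - nabla D X Y)
      - (nabla D' X (P.app Y) - nabla D X (P.app Y)) := by
  rw [hD'.nabla_app hX hY, nablaEnd, app_sub]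
  module

lemma IsNatural.app_nabla_of_eigen (hD' : IsNatural P D') (hX : IsSmoothVF X) (hY : IsSmoothVF Y)
    (h : P.app Y = ε • Y) : P.app (nabla D' X Y) = ε • nabla D' X Y := by
  rw [← hD'.nabla_app hX hY, h, nabla_smul_right D' X ε hY]

/-- As `∇P` is the commutator of `P` with `∇' - ∇`, only the gap between the eigenvalues survives:
`F` vanishes when its last two arguments are of one type. -/
lemma tensorF_eq (hP : IsAlmostProduct P) (hD' : IsNatural P D') (D : Conn m M) {η : ℝ}
    (hX : IsSmoothVF X) (hY : IsSmoothVF Y) (hPY : P.app Y = ε • Y) (hPZ : P.app Z = η • Z)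
    (p : M) :
    tensorF D P X Y Z p = (η - ε) * gmet (nabla D' X Y - nabla D X Y) Z p := by
  rw [tensorF, hD'.nablaEnd_eq D hX hY, hPY, nabla_smul_right D' X ε hY, nabla_smul_right D X ε hY,
    ← smul_sub, gmet_sub_left, hP.gmet_app_left, hPZ, gmet_smul_left, gmet_smul_right]
  ring

/-- In a `W₃`-manifold the difference of a natural connection and the Levi-Civita connection is
skew-symmetric in its first two arguments, when these are of one type and the third is of the
other type. -/
lemma gmet_nabla_sub_nabla_swap (hP : IsAlmostProduct P) (hD : IsLeviCivita D) (hW : IsW3 D P)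
    (hD' : IsNatural P D') (hε : ε * ε = 1) (hX : IsSmoothVF X) (hY : IsSmoothVF Y)
    (hC : IsSmoothVF C) (hPX : P.app X = ε • X) (hPY : P.app Y = ε • Y)
    (hPC : P.app C = (-ε) • C) (p : M) :
    gmet (nabla D' X Y - nabla D X Y) C p = -gmet (nabla D' Y X - nabla D Y X) C p := by
  have h := congrFun (hW X Y C hX hY hC) p
  simp only [Pi.add_apply, Pi.zero_apply] at h
  rw [tensorF_eq hP hD' D hX hY hPY hPC, tensorF_eq hP hD' D hY hC hPC hPX,
    tensorF_eq hP hD' D hC hX hPX hPY,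
    gmet_nabla_sub_nabla_skew hD.metric hD'.metric Y hC hX] at h
  linear_combination (-ε / 2) * h - (gmet (nabla D' X Y - nabla D X Y) C p
    + gmet (nabla D' Y X - nabla D Y X) C p) * hε

/-- Because `ε² = 1`, the last two terms of the torsion identity repeat the first two; `Y` may be of
any type. -/
lemma IsCanonical.gmet_torsionField_symm (hD' : IsCanonical P D') (hε : ε * ε = 1)
    (hX : IsSmoothVF X) (hY : IsSmoothVF Y) (hZ : IsSmoothVF Z) (hPX : P.app X = ε • X)
    (hPZ : P.app Z = ε • Z) (p : M) :
    gmet (torsionField D' X Y) Z p = gmet (torsionField D' Z Y) X p := by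
  have hx : P p (X p) = ε • X p := congrFun hPX p
  have hz : P p (Z p) = ε • Z p := congrFun hPZ p
  have h := hD'.torsion_eq p (X p) (Y p) (Z p)
  rw [hx, hz] at h
  simp only [torsion₃, map_smul, smul_apply, real_inner_smul_left,
    real_inner_smul_right, torsion_eq_torsionField D' hX hY, torsion_eq_torsionField D' hY hZ] at h
  change gmet (torsionField D' X Y) Z p + gmet (torsionField D' Y Z) X p
    + ε * (ε * gmet (torsionField D' X Y) Z p) + ε * (ε * gmet (torsionField D' Y Z) X p) = 0 at h
  rw [torsionField_swap D' Y Z, gmet_neg_left] at h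
  linear_combination h / 2 - (gmet (torsionField D' X Y) Z p
    - gmet (torsionField D' Z Y) X p) / 2 * hε

/-- A form that is skew in its first two arguments and symmetric in the first and third is zero. -/
lemma IsCanonical.gmet_torsionField_of_eigen (hD' : IsCanonical P D') (hε : ε * ε = 1)
    (hX : IsSmoothVF X) (hY : IsSmoothVF Y) (hZ : IsSmoothVF Z) (hPX : P.app X = ε • X)
    (hPY : P.app Y = ε • Y) (hPZ : P.app Z = ε • Z) (p : M) :
    gmet (torsionField D' X Y) Z p = 0 := by
  have h1 := hD'.gmet_torsionField_symm hε hX hY hZ hPX hPZ p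
  have h2 := hD'.gmet_torsionField_symm hε hY hZ hX hPY hPX p
  have h3 := hD'.gmet_torsionField_symm hε hY hX hZ hPY hPZ p
  rw [torsionField_swap D' Z Y, gmet_neg_left] at h1
  rw [torsionField_swap D' X Z, gmet_neg_left] at h2
  rw [torsionField_swap D' Y X, gmet_neg_left] at h3
  linarith

/-- The torsion of two eigenfields of one type is of the other type. -/
lemma IsCanonical.app_torsionField (hP : IsAlmostProduct P) (hD' : IsCanonical P D')
    (hε : ε * ε = 1) (hX : IsSmoothVF X) (hY : IsSmoothVF Y) (hPX : P.app X = ε • X)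
    (hPY : P.app Y = ε • Y) :
    P.app (torsionField D' X Y) = (-ε) • torsionField D' X Y :=
  hP.app_eq_neg_smul hε (hX.torsionField hD'.smooth hY) fun _ hZ hPZ p ↦
    hD'.gmet_torsionField_of_eigen hε hX hY hZ hPX hPY hPZ p

/-- The expression is symmetric in `X, Z` by the torsion identity and skew in them by `W₃` and the
compatibility of both connections with the metric. -/
lemma IsCanonical.gmet_torsionField_of_mixed (hP : IsAlmostProduct P) (hD : IsLeviCivita D)
    (hW : IsW3 D P) (hD' : IsCanonical P D') (hε : ε * ε = 1) (hX : IsSmoothVF X)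
    (hA : IsSmoothVF A) (hZ : IsSmoothVF Z) (hPX : P.app X = ε • X) (hPA : P.app A = (-ε) • A)
    (hPZ : P.app Z = ε • Z) (p : M) : gmet (torsionField D' X A) Z p = 0 := by
  have h1 := hD'.gmet_torsionField_symm hε hX hA hZ hPX hPZ p
  have h2 := gmet_nabla_sub_nabla_swap hP hD hW hD'.toIsNatural hε hX hZ hA hPX hPZ hPA p
  have h3 := gmet_nabla_sub_nabla_skew hD.metric hD'.metric X hA hZ p
  have h4 := gmet_nabla_sub_nabla_skew hD.metric hD'.metric Z hA hX p
  have h5 := gmet_nabla_sub_nabla_skew hD.metric hD'.metric A hX hZ p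
  rw [hD.gmet_torsionField D' hX hA, hD.gmet_torsionField D' hZ hA] at h1
  rw [hD.gmet_torsionField D' hX hA]
  linarith

/-- The torsion of two eigenfields of different types vanishes. -/
lemma IsCanonical.torsionField_eq_zero (hP : IsAlmostProduct P) (hD : IsLeviCivita D)
    (hW : IsW3 D P) (hD' : IsCanonical P D') (hε : ε * ε = 1) (hX : IsSmoothVF X)
    (hA : IsSmoothVF A) (hPX : P.app X = ε • X) (hPA : P.app A = (-ε) • A) :
    torsionField D' X A = 0 := by
  have hε' : -ε * -ε = 1 := by rw [neg_mul_neg, hε]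
  have hT := hX.torsionField hD'.smooth hA
  refine eq_zero_of_app_eq hε ?_ (hP.app_eq_neg_smul hε hT fun Z hZ hPZ p ↦
    hD'.gmet_torsionField_of_mixed hP hD hW hε hX hA hZ hPX hPA hPZ p)
  -- The component of type `-ε` is handled by the same lemma with `X` and `A` exchanged.
  rw [hP.app_eq_neg_smul hε' hT fun Z hZ hPZ p ↦ ?_, neg_neg]
  rw [torsionField_swap, gmet_neg_left, hD'.gmet_torsionField_of_mixed hP hD hW hε' hA hX hZ hPA
    (by rw [neg_neg, hPX]) hPZ p, neg_zero]

/-- On eigenfields of one type for the eigenvalue `ε`, `(∇_X P) Y` is `-ε` times the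
torsion of the canonical connection. -/
lemma IsCanonical.nablaEnd_eq_neg_smul (hP : IsAlmostProduct P) (hD : IsLeviCivita D)
    (hW : IsW3 D P) (hD' : IsCanonical P D') (hε : ε * ε = 1) (hX : IsSmoothVF X)
    (hY : IsSmoothVF Y) (hPX : P.app X = ε • X) (hPY : P.app Y = ε • Y) :
    nablaEnd D P X Y = (-ε) • torsionField D' X Y := by
  have hε' : -ε * -ε = 1 := by rw [neg_mul_neg, hε]
  have hT := hX.torsionField hD'.smooth hY
  have hPT := hD'.app_torsionField hP hε hX hY hPX hPY
  have hs : IsSmoothVF (nablaEnd D P X Y) :=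
    (hX.nabla hD.smooth (hY.app hP.smooth)).sub ((hX.nabla hD.smooth hY).app hP.smooth)
  have h1 : P.app (nablaEnd D P X Y + ε • torsionField D' X Y)
      = (-ε) • (nablaEnd D P X Y + ε • torsionField D' X Y) := by
    rw [app_add, app_smul, app_nablaEnd hP D hε X hY hPY, hPT]
    module
  have h2 : P.app (nablaEnd D P X Y + ε • torsionField D' X Y)
      = (-(-ε)) • (nablaEnd D P X Y + ε • torsionField D' X Y) := by
    -- The sum already has type `-ε`, so it suffices to test it against fields `C` of that type;
    -- there `F(X, Y, C) = -2ε g(S(X, Y), C)` and `g(T(X, Y), C) = 2 g(S(X, Y), C)`.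
    refine hP.app_eq_neg_smul hε' (hs.add (hT.smul ε)) fun C hC hPC p ↦ ?_
    have h3 := tensorF_eq hP hD'.toIsNatural D hX hY hPY hPC p
    have h4 := gmet_nabla_sub_nabla_swap hP hD hW hD'.toIsNatural hε hX hY hC hPX hPY hPC p
    rw [tensorF] at h3
    rw [gmet_add_left, gmet_smul_left, hD.gmet_torsionField D' hX hY, h3]
    linear_combination -ε * h4
  have h3 := eq_zero_of_app_eq hε' h1 h2
  linear_combination (norm := module) h3

/-- The first Bianchi identity for the curvature of the canonical connection forces the iterated
torsion to vanish. -/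
lemma IsCanonical.gmet_torsionField_torsionField (hP : IsAlmostProduct P) (hD : IsLeviCivita D)
    (hW : IsW3 D P) (hD' : IsCanonical P D') (hR : IsCurvatureLike (curvature₄ D'))
    (hε : ε * ε = 1) (hX : IsSmoothVF X) (hY : IsSmoothVF Y) (hA : IsSmoothVF A)
    (hZ : IsSmoothVF Z) (hPX : P.app X = ε • X) (hPY : P.app Y = ε • Y)
    (hPA : P.app A = (-ε) • A) (hPZ : P.app Z = ε • Z) (p : M) :
    gmet (torsionField D' A (torsionField D' X Y)) Z p = 0 := by
  have hε' : -ε * -ε = 1 := by rw [neg_mul_neg, hε]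
  have hnn {U : VF m M} (h : P.app U = ε • U) : P.app U = (-(-ε)) • U := by rw [h, neg_neg]
  have hT := hX.torsionField hD'.smooth hY
  have hPT := hD'.app_torsionField hP hε hX hY hPX hPY
  have split (U : VF m M) : U = (1 / 2 : ℝ) • (U + ε • P.app U)
      + (1 / 2 : ℝ) • (U + (-ε) • P.app U) := by module
  -- Brackets such as `[Y, A]` have no definite type, so `U` is split: one part gives zero torsion
  -- with `V`, the other gives torsion orthogonal to `Z`.
  have same {V U : VF m M} (hV : IsSmoothVF V) (hU : IsSmoothVF U) (hPV : P.app V = ε • V) :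
      gmet (torsionField D' V U) Z p = 0 := by
    have s1 := hU.add ((hU.app hP.smooth).smul ε)
    have s2 := hU.add ((hU.app hP.smooth).smul (-ε))
    rw [split U, torsionField_add_right D' hV (s1.smul _) (s2.smul _),
      torsionField_smul_right D' _ hV s1, torsionField_smul_right D' _ hV s2,
      hD'.torsionField_eq_zero hP hD hW hε hV s2 hPV (hP.app_add_smul hε' U), gmet_add_left,
      smul_zero, gmet_smul_left, hD'.gmet_torsionField_of_eigen hε hV s1 hZ hPV
        (hP.app_add_smul hε U) hPZ]
    simp [gmet]
  have hb := hX.mlieBracket hY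
  have mixed : torsionField D' A (VectorField.mlieBracket (𝓡 m) X Y)
      = - torsionField D' A (torsionField D' X Y) := by
    -- `[X, Y]` differs from `-T(X, Y)` by this field of type `ε`, whose torsion with `A` vanishes.
    have s : IsSmoothVF (nabla D' X Y - nabla D' Y X) :=
      (hX.nabla hD'.smooth hY).sub (hY.nabla hD'.smooth hX)
    have e : VectorField.mlieBracket (𝓡 m) X Y
        = (nabla D' X Y - nabla D' Y X) - torsionField D' X Y := by
      rw [torsionField]
      module
    rw [e, torsionField_sub_right D' hA s hT, hD'.torsionField_eq_zero hP hD hW hε' hA s hPA,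
      zero_sub]
    rw [app_sub, hD'.app_nabla_of_eigen hX hY hPY, hD'.app_nabla_of_eigen hY hX hPX]
    module
  have h := congrFun (hR.bianchi X Y A Z hX hY hA hZ) p
  simp only [curvature₄, Pi.add_apply, Pi.zero_apply] at h
  rw [← gmet_add_left, ← gmet_add_left, curvature_cyclic_sum hD'.smooth hX hY hA,
    hD'.torsionField_eq_zero hP hD hW hε hY hA hPY hPA,
    hD'.torsionField_eq_zero hP hD hW hε' hA hX hPA (hnn hPX), mixed] at h
  simp only [gmet_add_left, gmet_neg_left, same hX (hY.mlieBracket hA) hPX,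
    same hY (hA.mlieBracket hX) hPY] at h
  have h0 (V : VF m M) : nabla D' V 0 = 0 := funext fun q ↦ by simp [nabla]
  have h1 : gmet (nabla D' A (torsionField D' X Y)) Z p = 0 := by
    rw [gmet_comm]
    exact hP.gmet_eq_zero hε hPZ (hD'.app_nabla_of_eigen hA hT hPT) p
  have h2 : gmet (0 : VF m M) Z p = 0 := by simp [gmet]
  rw [h0, h0, h1, h2] at h
  linarith

lemma IsCanonical.gmet_nablaEnd_nablaEnd (hP : IsAlmostProduct P) (hD : IsLeviCivita D)
    (hW : IsW3 D P) (hD' : IsCanonical P D') (hR : IsCurvatureLike (curvature₄ D'))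
    (hε : ε * ε = 1) (hX : IsSmoothVF X) (hY : IsSmoothVF Y) (hA : IsSmoothVF A)
    (hZ : IsSmoothVF Z) (hPX : P.app X = ε • X) (hPY : P.app Y = ε • Y)
    (hPA : P.app A = (-ε) • A) (hPZ : P.app Z = ε • Z) (p : M) :
    gmet (nablaEnd D P X Y) (nablaEnd D P A Z) p = 0 := by
  have hε' : -ε * -ε = 1 := by rw [neg_mul_neg, hε]
  have hnn : P.app Z = (-(-ε)) • Z := by rw [hPZ, neg_neg]
  have hT := hX.torsionField hD'.smooth hY
  have hPT := hD'.app_torsionField hP hε hX hY hPX hPY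
  have h0 := hD'.gmet_torsionField_torsionField hP hD hW hR hε hX hY hA hZ hPX hPY hPA hPZ p
  have h1 := tensorF_eq hP hD'.toIsNatural D hA hZ hPZ hPT p
  have h2 := gmet_nabla_sub_nabla_skew hD.metric hD'.metric A hZ hT p
  have h3 := gmet_nabla_sub_nabla_swap hP hD hW hD'.toIsNatural hε' hA hT hZ hPA hPT hnn p
  rw [hD.gmet_torsionField D' hA hT] at h0
  rw [tensorF] at h1
  rw [gmet_comm, hD'.nablaEnd_eq_neg_smul hP hD hW hε hX hY hPX hPY, gmet_smul_right, h1, h2]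
  -- `A` and `T(X, Y)` are both of type `-ε`, so `h3` turns `h0` into the vanishing of `2 g(S(A,
  -- T(X, Y)), Z)`.
  linear_combination -ε * ε * (h0 + h3)

end Canonical

end AlmostProduct

end

/-! ### Reduction of the theorem to eigenfields. -/

theorem theorem5p2 {m : ℕ} {M : Type*} [TopologicalSpace M] [T2Space M]
    [ChartedSpace (EuclideanSpace ℝ (Fin m)) M] [IsManifold (𝓡 m) ∞ M]
    [RiemannianBundle (fun p : M ↦ TangentSpace (𝓡 m) p)]
    [IsContMDiffRiemannianBundle (𝓡 m) ∞ (EuclideanSpace ℝ (Fin m))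
      (fun p : M ↦ TangentSpace (𝓡 m) p)]
    (P : AlmostProduct.EndField m M) (hP : AlmostProduct.IsAlmostProduct P)
    (D : AlmostProduct.Conn m M) (hD : AlmostProduct.IsLeviCivita D)
    (hW : AlmostProduct.IsW3 D P)
    (D' : AlmostProduct.Conn m M) (hD' : AlmostProduct.IsCanonical P D')
    (hR : AlmostProduct.IsRiemannianPTensor P (AlmostProduct.curvature₄ D'))
    (x y z w : AlmostProduct.VF m M)
    (hx : AlmostProduct.IsSmoothVF x) (hy : AlmostProduct.IsSmoothVF y)
    (hz : AlmostProduct.IsSmoothVF z) (hw : AlmostProduct.IsSmoothVF w) :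
    AlmostProduct.gmet
      (AlmostProduct.nablaEnd D P x (P.app z) + AlmostProduct.nablaEnd D P (P.app x) z)
      (AlmostProduct.nablaEnd D P (P.app y) w - AlmostProduct.nablaEnd D P y (P.app w)) = 0 := by
  funext p
  have h1 : (1 : ℝ) * 1 = 1 := one_mul 1
  have h2 : (-1 : ℝ) * -1 = 1 := by norm_num
  have hs {X : AlmostProduct.VF m M} (hX : AlmostProduct.IsSmoothVF X) := hX.app hP.smooth
  have plus (X : AlmostProduct.VF m M) : P.app (X + P.app X) = (1 : ℝ) • (X + P.app X) := by
    rw [AlmostProduct.app_add, hP.app_app]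
    module
  have minus (X : AlmostProduct.VF m M) : P.app (X - P.app X) = (-1 : ℝ) • (X - P.app X) := by
    rw [AlmostProduct.app_sub, hP.app_app]
    module
  have expand {X Y : AlmostProduct.VF m M} (hY : AlmostProduct.IsSmoothVF Y) :=
    And.intro (AlmostProduct.nablaEnd_add_right D hP.smooth X hY (hs hY))
      (AlmostProduct.nablaEnd_sub_right D hP.smooth X hY (hs hY))
  -- In eigencomponents the first factor keeps only the pairs of equal type; the second, in `e2`,
  -- only those of different types.
  have e1 : AlmostProduct.nablaEnd D P x (P.app z) + AlmostProduct.nablaEnd D P (P.app x) z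
      = (1 / 2 : ℝ) • (AlmostProduct.nablaEnd D P (x + P.app x) (z + P.app z)
        - AlmostProduct.nablaEnd D P (x - P.app x) (z - P.app z)) := by
    simp only [(expand hz).1, (expand hz).2, AlmostProduct.nablaEnd_add_left,
      AlmostProduct.nablaEnd_sub_left]
    module
  have e2 : AlmostProduct.nablaEnd D P (P.app y) w - AlmostProduct.nablaEnd D P y (P.app w)
      = (1 / 2 : ℝ) • (AlmostProduct.nablaEnd D P (y + P.app y) (w - P.app w)
        - AlmostProduct.nablaEnd D P (y - P.app y) (w + P.app w)) := by
    simp only [(expand hw).1, (expand hw).2, AlmostProduct.nablaEnd_add_left,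
      AlmostProduct.nablaEnd_sub_left]
    module
  have splus {X : AlmostProduct.VF m M} (hX : AlmostProduct.IsSmoothVF X) := hX.add (hs hX)
  have sminus {X : AlmostProduct.VF m M} (hX : AlmostProduct.IsSmoothVF X) := hX.sub (hs hX)
  have n {X : AlmostProduct.VF m M} (h : P.app X = (1 : ℝ) • X) :
      P.app X = (-(-1 : ℝ)) • X := by rw [h, neg_neg]
  -- `∇P` exchanges types, so its values on fields of different types are orthogonal, whatever the
  -- directions of differentiation.
  have ortho (U V : AlmostProduct.VF m M) {Z W : AlmostProduct.VF m M}
      (hZ : AlmostProduct.IsSmoothVF Z) (hW : AlmostProduct.IsSmoothVF W)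
      (hPZ : P.app Z = (1 : ℝ) • Z) (hPW : P.app W = (-1 : ℝ) • W) :
      AlmostProduct.gmet (AlmostProduct.nablaEnd D P U Z) (AlmostProduct.nablaEnd D P V W) p = 0 :=
    hP.gmet_eq_zero h2 (AlmostProduct.app_nablaEnd hP D h1 U hZ hPZ)
      (AlmostProduct.app_nablaEnd hP D h2 V hW hPW) p
  have g1 := ortho (x + P.app x) (y + P.app y) (splus hz) (sminus hw) (plus z) (minus w)
  have g2 := ortho (y - P.app y) (x - P.app x) (splus hw) (sminus hz) (plus w) (minus z)
  rw [AlmostProduct.gmet_comm] at g2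
  have g3 := hD'.gmet_nablaEnd_nablaEnd hP hD hW hR.toIsCurvatureLike h1 (splus hx) (splus hz)
    (sminus hy) (splus hw) (plus x) (plus z) (minus y) (plus w) p
  have g4 := hD'.gmet_nablaEnd_nablaEnd hP hD hW hR.toIsCurvatureLike h2 (sminus hx) (sminus hz)
    (splus hy) (sminus hw) (minus x) (minus z) (n (plus y)) (minus w) p
  rw [e1, e2, AlmostProduct.gmet_smul_left, AlmostProduct.gmet_smul_right,
    AlmostProduct.gmet_sub_left, AlmostProduct.gmet_sub_right, AlmostProduct.gmet_sub_right,
    g1, g2, g3, g4, Pi.zero_apply]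
  norm_num
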